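/- Let $G=PSL(2,\mathbb Z)$ be the modular group, generated by the linear fractional transformations $x:z\mapsto -1/z$ and $y:z\mapsto (z-1)/z$ (with $x^2=y^3=1$). For a positive integer $n$ that is not a square put $$Q^*(\sqrt n)=\Bigl\{\tfrac{a+\sqrt n}{c} : a,\ c\ne 0,\ b=\tfrac{a^2-n}{c}\in\mathbb Z,\ \gcd(a,b,c)=1\Bigr\},$$ a set of irrational real numbers on which $G$ acts by linear fractional transformations. Let $h=2k+1\ge 3$ be an odd integer. Then the action of $G$ on $Q^*(\sqrt{2^h})$ has exactly two orbits, namely the orbit $(2^k\sqrt2)^G$ of $2^k\sqrt2$ and the orbit $\bigl(\tfrac{2^k\sqrt2}{-1}\bigr)^G$ of $-2^k\sqrt2$; these two orbits are distinct. -/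

import Mathlib

open scoped MatrixGroups

/-- The irrational real numbers. -/
abbrev IrrationalReal : Type := {x : ℝ // Irrational x}

namespace IrrationalReal

/-- The denominator of a linear fractional transformation does not vanish at an irrational point. -/
theorem denom_ne_zero (g : SL(2, ℤ)) (z : IrrationalReal) :
    ((g 1 0 : ℤ) : ℝ) * (z : ℝ) + ((g 1 1 : ℤ) : ℝ) ≠ 0 := by
  intro h
  have hdet := Matrix.det_fin_two g.1
  rw [g.2] at hdet
  by_cases h0 : g 1 0 = 0
  · have h1 : g 1 1 = 0 := by
      rw [h0] at h
      simpa using h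
    simp [h0, h1] at hdet
  · exact ((z.2.intCast_mul h0).add_intCast (g 1 1)).ne_zero h

/-- The linear fractional transformation `z ↦ (p z + q) / (r z + t)` given by a matrix
`(p, q; r, t)` of `SL(2, ℤ)`, on real numbers. -/
noncomputable def moebius (g : SL(2, ℤ)) (z : ℝ) : ℝ :=
  (((g 0 0 : ℤ) : ℝ) * z + ((g 0 1 : ℤ) : ℝ)) / (((g 1 0 : ℤ) : ℝ) * z + ((g 1 1 : ℤ) : ℝ))

theorem moebius_one (z : ℝ) : moebius 1 z = z := by
  simp [moebius]

theorem moebius_mul (g h : SL(2, ℤ)) (z : IrrationalReal) :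
    moebius (g * h) z = moebius g (moebius h z) := by
  have h1 := denom_ne_zero h z
  have h2 := denom_ne_zero (g * h) z
  simp only [moebius, Matrix.SpecialLinearGroup.coe_mul, Matrix.mul_apply,
    Fin.sum_univ_two] at h2 ⊢
  push_cast at h2 ⊢
  have e : ∀ u v : ℝ,
      u * ((((h 0 0 : ℤ) : ℝ) * z + ((h 0 1 : ℤ) : ℝ)) /
        (((h 1 0 : ℤ) : ℝ) * z + ((h 1 1 : ℤ) : ℝ))) + v =
      ((u * ((h 0 0 : ℤ) : ℝ) + v * ((h 1 0 : ℤ) : ℝ)) * z +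
        (u * ((h 0 1 : ℤ) : ℝ) + v * ((h 1 1 : ℤ) : ℝ))) /
        (((h 1 0 : ℤ) : ℝ) * z + ((h 1 1 : ℤ) : ℝ)) := by
    intro u v
    rw [eq_div_iff h1, add_mul, mul_assoc, div_mul_cancel₀ _ h1]
    ring
  rw [e, e, div_div_div_cancel_right₀ h1]

theorem irrational_moebius (g : SL(2, ℤ)) (z : IrrationalReal) : Irrational (moebius g z) := by
  rintro ⟨w, hw⟩
  apply z.2
  have h := moebius_mul g⁻¹ g z
  rw [inv_mul_cancel, moebius_one, ← hw] at h
  rw [h]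
  refine ⟨((g⁻¹ 0 0 : ℤ) * w + (g⁻¹ 0 1 : ℤ)) / ((g⁻¹ 1 0 : ℤ) * w + (g⁻¹ 1 1 : ℤ)), ?_⟩
  simp only [moebius]
  push_cast
  rfl

/-- `SL(2, ℤ)` acts on the irrational numbers by linear fractional transformations. -/
noncomputable instance instMulActionSL : MulAction SL(2, ℤ) IrrationalReal where
  smul g z := ⟨moebius g z, irrational_moebius g z⟩
  one_smul z := Subtype.ext (moebius_one z)
  mul_smul g h z := Subtype.ext (moebius_mul g h z)

theorem coe_smul (g : SL(2, ℤ)) (z : IrrationalReal) :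
    ((g • z : IrrationalReal) : ℝ) =
      (((g 0 0 : ℤ) : ℝ) * (z : ℝ) + ((g 0 1 : ℤ) : ℝ)) /
        (((g 1 0 : ℤ) : ℝ) * (z : ℝ) + ((g 1 1 : ℤ) : ℝ)) := rfl

/-- Central matrices are scalar, so they act trivially. -/
theorem center_le_ker :
    Subgroup.center SL(2, ℤ) ≤ (MulAction.toPermHom SL(2, ℤ) IrrationalReal).ker := by
  intro g hg
  rw [MonoidHom.mem_ker]
  ext z
  have hs := Matrix.SpecialLinearGroup.scalar_eq_self_of_mem_center hg 0
  rw [Matrix.scalar_apply] at hs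
  have h01 : g 0 1 = 0 := by simpa using (congrFun (congrFun hs 0) 1).symm
  have h10 : g 1 0 = 0 := by simpa using (congrFun (congrFun hs 1) 0).symm
  have h11 : g 1 1 = g 0 0 := by simpa using (congrFun (congrFun hs 1) 1).symm
  have hd := denom_ne_zero g z
  rw [h10, h11] at hd
  rw [MulAction.toPermHom_apply, MulAction.toPerm_apply, coe_smul, h01, h10, h11,
    Equiv.Perm.one_apply]
  simp only [Int.cast_zero, zero_mul, zero_add, add_zero] at hd ⊢
  field_simp

/-- The modular group `PSL(2, ℤ)` acts on the irrational numbers by linear fractional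
transformations. -/
noncomputable instance instMulActionPSL : MulAction PSL(2, ℤ) IrrationalReal :=
  MulAction.compHom IrrationalReal
    (QuotientGroup.lift (Subgroup.center SL(2, ℤ))
      (MulAction.toPermHom SL(2, ℤ) IrrationalReal) center_le_ker)

/-- The class of the matrix `g` acts as `g`. -/
theorem mk_smul (g : SL(2, ℤ)) (z : IrrationalReal) :
    (QuotientGroup.mk g : PSL(2, ℤ)) • z = g • z := rfl

end IrrationalReal

/-- `α` is of the form `(a + √n) / c` with `a`, `c` and `b = (a² - n) / c` integers such that
`gcd(a, b, c) = 1`. -/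
def IsQstar (n : ℕ) (α : ℝ) : Prop :=
  ∃ a b c : ℤ, c ≠ 0 ∧ α = ((a : ℝ) + √(n : ℝ)) / (c : ℝ) ∧ a ^ 2 - (n : ℤ) = b * c ∧
    Int.gcd (Int.gcd a b) c = 1

theorem IsQstar.smul {n : ℕ} {z : IrrationalReal} (hz : IsQstar n z) (g : SL(2, ℤ)) :
    IsQstar n ((g • z : IrrationalReal) : ℝ) := by
  obtain ⟨a, b, c, hc, hα, hbc, hgcd⟩ := hz
  have hden := IrrationalReal.denom_ne_zero g z
  have hirr := z.2
  rw [IrrationalReal.coe_smul]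
  have hdet := Matrix.det_fin_two g.1
  rw [g.2] at hdet
  change 1 = g 0 0 * g 1 1 - g 0 1 * g 1 0 at hdet
  generalize g 0 0 = p at *
  generalize g 0 1 = q at *
  generalize g 1 0 = r at *
  generalize g 1 1 = t at *
  have hs : √(n : ℝ) ^ 2 = n := Real.sq_sqrt (Nat.cast_nonneg n)
  have hbcR : (a : ℝ) ^ 2 - n = b * c := by exact_mod_cast hbc
  have hcR : (c : ℝ) ≠ 0 := by exact_mod_cast hc
  have hdetR : (1 : ℝ) = p * t - q * r := by exact_mod_cast hdet
  obtain ⟨a', ha'⟩ : ∃ a', a' = p * r * b + (p * t + q * r) * a + q * t * c := ⟨_, rfl⟩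
  obtain ⟨b', hb'⟩ : ∃ b', b' = p ^ 2 * b + 2 * p * q * a + q ^ 2 * c := ⟨_, rfl⟩
  obtain ⟨c', hc'⟩ : ∃ c', c' = r ^ 2 * b + 2 * r * t * a + t ^ 2 * c := ⟨_, rfl⟩
  have key : a' ^ 2 - (n : ℤ) = b' * c' := by
    have hn : (n : ℤ) = (a ^ 2 - b * c) * (p * t - q * r) ^ 2 := by
      rw [← hdet]; linear_combination -hbc
    rw [hn, ha', hb', hc']; ring
  have hc'0 : c' ≠ 0 := by
    intro h0
    rw [h0, mul_zero, sub_eq_zero] at key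
    have hsq : √(n : ℝ) = ((|a'| : ℤ) : ℝ) := by
      have : (n : ℝ) = (a' : ℝ) ^ 2 := by exact_mod_cast key.symm
      rw [this, Real.sqrt_sq_eq_abs, Int.cast_abs]
    apply hirr
    refine ⟨((a : ℚ) + ((|a'| : ℤ) : ℚ)) / (c : ℚ), ?_⟩
    rw [hα, hsq]
    push_cast
    rfl
  refine ⟨a', b', c', hc'0, ?_, key, ?_⟩
  · have hc'R : (c' : ℝ) ≠ 0 := by exact_mod_cast hc'0
    rw [div_eq_div_iff hden hc'R, hα]
    have ea : (a' : ℝ) = p * r * b + (p * t + q * r) * a + q * t * c := by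
      rw [ha']; push_cast; ring
    have ec : (c' : ℝ) = r ^ 2 * b + 2 * r * t * a + t ^ 2 * c := by
      rw [hc']; push_cast; ring
    rw [ea, ec]
    have e : ∀ u v : ℝ, u * (((a : ℝ) + √(n : ℝ)) / c) + v =
        (u * ((a : ℝ) + √(n : ℝ)) + v * c) / c := by
      intro u v; field_simp
    rw [e, e, div_mul_eq_mul_div, mul_div_assoc', div_left_inj' hcR]
    have hb : (b : ℝ) * c = a ^ 2 - √(n : ℝ) ^ 2 := by rw [hs, hbcR]
    generalize √(n : ℝ) = s at *
    linear_combination (-(r * (p * t - q * r))) * hb - (r * s * (a + s) + s * t * c) * hdetR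
  · have hdvd : ∀ d : ℤ, d ∣ a' → d ∣ b' → d ∣ c' → d ∣ 1 := by
      intro d h1 h2 h3
      have ea : a = -(t * r) * b' + (p * t + q * r) * a' - q * p * c' := by
        have : a = a * (p * t - q * r) ^ 2 := by rw [← hdet]; ring
        rw [ha', hb', hc']; linear_combination this
      have eb : b = t ^ 2 * b' - 2 * t * q * a' + q ^ 2 * c' := by
        have : b = b * (p * t - q * r) ^ 2 := by rw [← hdet]; ring
        rw [ha', hb', hc']; linear_combination this
      have ec : c = r ^ 2 * b' - 2 * r * p * a' + p ^ 2 * c' := by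
        have : c = c * (p * t - q * r) ^ 2 := by rw [← hdet]; ring
        rw [ha', hb', hc']; linear_combination this
      have da : d ∣ a := by
        rw [ea]
        exact dvd_sub (dvd_add (h2.mul_left _) (h1.mul_left _)) (h3.mul_left _)
      have db : d ∣ b := by
        rw [eb]
        exact dvd_add (dvd_sub (h2.mul_left _) (h1.mul_left _)) (h3.mul_left _)
      have dc : d ∣ c := by
        rw [ec]
        exact dvd_add (dvd_sub (h2.mul_left _) (h1.mul_left _)) (h3.mul_left _)
      have := Int.dvd_coe_gcd (Int.dvd_coe_gcd da db) dc
      rwa [hgcd] at this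
    have h1 : ((Int.gcd (Int.gcd a' b') c' : ℕ) : ℤ) ∣ 1 :=
      hdvd _ ((Int.gcd_dvd_left _ _).trans (Int.gcd_dvd_left _ _))
        ((Int.gcd_dvd_left _ _).trans (Int.gcd_dvd_right _ _)) (Int.gcd_dvd_right _ _)
    have h2 : Int.gcd (Int.gcd a' b') c' ∣ 1 := by exact_mod_cast h1
    exact Nat.dvd_one.mp h2

/-- The set `Q*(√n)` of the numbers `(a + √n) / c` with `a`, `c` and `b = (a² - n) / c` integers
such that `gcd(a, b, c) = 1`, as a `G`-subset of the irrational numbers, for `G = PSL(2, ℤ)`.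
It is meant for `n` that is not a square; then every number of this form is irrational. -/
noncomputable def Qstar (n : ℕ) : SubMulAction PSL(2, ℤ) IrrationalReal where
  carrier := {z | IsQstar n (z : ℝ)}
  smul_mem' g z hz := by
    induction g using QuotientGroup.induction_on with
    | H g => exact IsQstar.smul hz g

/-!
Attach to `(a + √n) / c`, with `a ^ 2 - n = b * c`, the binary quadratic form
`b * x ^ 2 + 2 * a * x * y + c * y ^ 2`. If it takes a value `e = ±1` at `(r, t)`, then the matrix
with rows `(e * (r * a + t * c), -e * (r * b + t * a))` and `(r, t)` has determinant `e ^ 2 = 1`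
and sends `(a + √n) / c` to `e * √n` (`IrrationalReal.exists_smul_eq_of_form_eq`). So there are at
most two orbits as soon as every primitive form with `n = 2 ^ (2 * k + 1)` represents `1` or `-1`
(`exists_form_sq_eq_one`).

For this, one may take `c` odd, and then `a` divisible by `2 ^ k`, so that the form is
`Q' (2 ^ k * x, y)` for a form `Q'` with `a' ^ 2 - b' * c = 2`. As `ℤ[√2]` has class number one and
a unit of norm `-1`, `Q'` is the norm `X ^ 2 - 2 * Y ^ 2` in some basis of `ℤ[√2]`
(`exists_eq_norm_form`). It remains to find a unit of `ℤ[√2]` in the sublattice of index `2 ^ k`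
on which the first coordinate is divisible by `2 ^ k` (`exists_unit_dvd`). This is possible since
the powers of `1 + √2` contain, for every `j`, a unit `A + B * √2` in which `2 ^ j` divides `B`
exactly, and multiplication by it corrects the divisibility at the `j`-th step.

The two orbits differ because a matrix taking `√n` to `-√n` gives a solution of
`p ^ 2 - n * r ^ 2 = -1`, which is impossible modulo `4` when `4 ∣ n`.
-/

/-! ### Units of `ℤ[√2]` -/

/-- The unit `(1 + √2) ^ (2 ^ j)`, written `A + 2 ^ j * B * √2`, has `A` and `B` odd. -/
theorem exists_unit_exact_dvd (j : ℕ) :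
    ∃ A B : ℤ, Odd A ∧ Odd B ∧ (A ^ 2 - 2 * (2 ^ j * B) ^ 2) ^ 2 = 1 := by
  induction j with
  | zero => exact ⟨1, 1, odd_one, odd_one, by norm_num⟩
  | succ j ih =>
    obtain ⟨A, B, hA, hB, h⟩ := ih
    refine ⟨A ^ 2 + 2 * (2 ^ j * B) ^ 2, A * B, hA.pow.add_even (even_two_mul _), hA.mul hB, ?_⟩
    have e : (A ^ 2 + 2 * (2 ^ j * B) ^ 2) ^ 2 - 2 * (2 ^ (j + 1) * (A * B)) ^ 2 =
        (A ^ 2 - 2 * (2 ^ j * B) ^ 2) ^ 2 := by ring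
    rw [e, h, one_pow]

/-- For odd `q`, the sublattice of `ℤ[√2]` formed by the `X + Y * √2` with
`2 ^ k ∣ s * X - q * Y` contains a unit. -/
theorem exists_unit_dvd (s q : ℤ) (hq : Odd q) (k : ℕ) :
    ∃ X Y : ℤ, (X ^ 2 - 2 * Y ^ 2) ^ 2 = 1 ∧ (2 : ℤ) ^ k ∣ s * X - q * Y := by
  induction k with
  | zero => exact ⟨1, 0, by norm_num, by simp⟩
  | succ k ih =>
    obtain ⟨X, Y, hn, m, hm⟩ := ih
    obtain ⟨m', rfl | rfl⟩ := Int.even_or_odd' m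
    · exact ⟨X, Y, hn, m', by rw [hm]; ring⟩
    · have hX : Odd X := by
        have h1 : Odd ((X ^ 2 - 2 * Y ^ 2) ^ 2) := hn ▸ odd_one
        have h2 : Odd (X ^ 2) := by
          have := (Int.odd_pow' two_ne_zero).1 h1
          rw [show X ^ 2 = X ^ 2 - 2 * Y ^ 2 + 2 * Y ^ 2 by ring]
          exact this.add_even (even_two_mul _)
        exact (Int.odd_pow' two_ne_zero).1 h2
      -- Here `s * X - q * Y` is an odd multiple of `2 ^ k`. Multiplying by `A + 2 ^ k * B * √2`
      -- scales it by `A` and, modulo `2 ^ (k + 1)`, adds the odd multiple `-q * X * B` of `2 ^ k`.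
      obtain ⟨A, B, hA, hB, hu⟩ := exists_unit_exact_dvd k
      refine ⟨X * A + 2 * Y * (2 ^ k * B), X * (2 ^ k * B) + Y * A, ?_, ?_⟩
      · have e : (X * A + 2 * Y * (2 ^ k * B)) ^ 2 - 2 * (X * (2 ^ k * B) + Y * A) ^ 2 =
            (X ^ 2 - 2 * Y ^ 2) * (A ^ 2 - 2 * (2 ^ k * B) ^ 2) := by ring
        rw [e, mul_pow, hn, hu, one_mul]
      · have hev : Even ((2 * m' + 1) * A - q * X * B + 2 * (s * Y * B)) :=
          (((odd_two_mul_add_one m').mul hA).sub_odd ((hq.mul hX).mul hB)).add (even_two_mul _)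
        obtain ⟨w, hw⟩ := hev.two_dvd
        refine ⟨w, ?_⟩
        linear_combination A * hm + 2 ^ k * hw

/-! ### Forms representing a unit -/

/-- Class number one: a form `b * u ^ 2 + 2 * a * u * v + c * v ^ 2` with `a ^ 2 - b * c = 2` is
`(p * u + q * v) ^ 2 - 2 * (r * u + s * v) ^ 2` for some unimodular matrix `(p, q; r, s)`. -/
theorem exists_eq_norm_form (a b c : ℤ) (h : a ^ 2 - 2 = b * c) :
    ∃ p q r s : ℤ, b = p ^ 2 - 2 * r ^ 2 ∧ a = p * q - 2 * r * s ∧ c = q ^ 2 - 2 * s ^ 2 ∧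
      (p * s - q * r) ^ 2 = 1 := by
  induction hN : c.natAbs using Nat.strong_induction_on generalizing a b c with
  | _ N ih =>
    have hc0 : c ≠ 0 := by
      rintro rfl
      have h2 : a ^ 2 = 2 := by linarith
      have h3 : a < 2 := by nlinarith
      have h4 : -2 < a := by nlinarith
      interval_cases a <;> omega
    -- Shift `v` by a multiple `t` of `u` so that the middle coefficient becomes `d`,
    -- with `2 * |d| ≤ |c|`.
    obtain ⟨d, t, hd, hd1, hd2⟩ : ∃ d t : ℤ, d = a + t * c ∧ 2 * d ≤ |c| ∧ -|c| ≤ 2 * d := by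
      have h1 := Int.emod_add_mul_ediv a c
      have h2 := Int.emod_nonneg a hc0
      have h3 := Int.emod_lt_abs a hc0
      by_cases hle : 2 * (a % c) ≤ |c|
      · exact ⟨a % c, -(a / c), by linear_combination h1, hle, by omega⟩
      · refine ⟨a % c - |c|, -(a / c) - c.sign, ?_, by omega, by omega⟩
        rw [← Int.sign_mul_self_eq_abs]
        linear_combination h1
    obtain ⟨f, hf⟩ : ∃ f : ℤ, f = b + 2 * a * t + c * t ^ 2 := ⟨_, rfl⟩
    have hdf : d ^ 2 - 2 = f * c := by rw [hd, hf]; linear_combination h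
    -- It is enough to treat the shifted form.
    suffices H : ∃ p q r s : ℤ, f = p ^ 2 - 2 * r ^ 2 ∧ d = p * q - 2 * r * s ∧
        c = q ^ 2 - 2 * s ^ 2 ∧ (p * s - q * r) ^ 2 = 1 by
      obtain ⟨p, q, r, s, h1, h2, h3, h4⟩ := H
      refine ⟨p - t * q, q, r - t * s, s, ?_, ?_, h3, ?_⟩
      · linear_combination h1 - hf - 2 * t * h2 + 2 * t * hd + t ^ 2 * h3
      · linear_combination h2 - hd - t * h3
      · linear_combination h4
    by_cases hc1 : |c| = 1
    · have hd0 : d = 0 := by omega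
      subst hd0
      rcases (abs_eq zero_le_one).1 hc1 with rfl | rfl
      · exact ⟨0, 1, 1, 0, by linarith, by norm_num, by norm_num, by norm_num⟩
      · -- The basis `2 + √2`, `1 + √2` is `√2`, `1` multiplied by a unit of norm `-1`.
        exact ⟨2, 1, 1, 1, by linarith, by norm_num, by norm_num, by norm_num⟩
    · have hlt : |f| < |c| := by
        have hpos : 0 < |c| := abs_pos.2 hc0
        have hc2 : 2 ≤ |c| := by omega
        have h1 : |f| * |c| < |c| * |c| := by
          rw [← abs_mul, ← hdf, abs_lt]
          constructor <;> nlinarith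
        exact lt_of_mul_lt_mul_right h1 hpos.le
      obtain ⟨p, q, r, s, h1, h2, h3, h4⟩ :=
        ih f.natAbs (by rw [← hN]; exact Int.natAbs_lt_iff_sq_lt.2 (sq_lt_sq.2 hlt)) d c f
          (by rw [hdf, mul_comm]) rfl
      exact ⟨q, p, s, r, h3, by rw [h2]; ring, h1, by rw [← h4]; ring⟩

theorem exists_form_sq_eq_one_of_odd (k : ℕ) (a b c : ℤ) (h : a ^ 2 - 2 ^ (2 * k + 1) = b * c)
    (hc : Odd c) :
    ∃ x y : ℤ, (b * x ^ 2 + 2 * a * x * y + c * y ^ 2) ^ 2 = 1 := by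
  have hcop : IsCoprime c 2 := Int.isCoprime_iff_gcd_eq_one.2 (by
    obtain ⟨m, rfl⟩ := hc
    simp)
  -- As `c` is odd, shifting `y` by `t * x` makes the middle coefficient divisible by `2 ^ k`.
  obtain ⟨t, a', ha'⟩ : ∃ t a' : ℤ, a + t * c = 2 ^ k * a' := by
    obtain ⟨u, v, huv⟩ := hcop.pow_right (n := k)
    exact ⟨-a * u, a * v, by linear_combination -a * huv⟩
  obtain ⟨b', hb'⟩ : (2 : ℤ) ^ (2 * k) ∣ b + 2 * a * t + c * t ^ 2 := by
    refine (hcop.symm.pow_left (m := 2 * k)).dvd_of_dvd_mul_right (z := c) ⟨a' ^ 2 - 2, ?_⟩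
    linear_combination -h + (a + t * c + 2 ^ k * a') * ha'
  have h' : a' ^ 2 - 2 = b' * c := by
    have h0 : (2 : ℤ) ^ (2 * k) ≠ 0 := by positivity
    apply mul_left_cancel₀ h0
    linear_combination h - (a + t * c + 2 ^ k * a') * ha' + c * hb'
  obtain ⟨p, q, r, s, h1, h2, h3, h4⟩ := exists_eq_norm_form a' b' c h'
  have hq : Odd q := by
    have : Odd (q ^ 2) := by
      rw [show q ^ 2 = c + 2 * s ^ 2 by rw [h3]; ring]
      exact hc.add_even (even_two_mul _)
    exact (Int.odd_pow' two_ne_zero).1 this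
  obtain ⟨X, Y, hXY, m, hm⟩ := exists_unit_dvd s q hq k
  -- The coordinates of `X + Y * √2` in the basis `p + r * √2`, `q + s * √2` are
  -- `δ * (s * X - q * Y)` and `δ * (p * Y - r * X)` for `δ = p * s - q * r`; the sign `δ` is
  -- irrelevant.
  refine ⟨m, p * Y - r * X + t * m, ?_⟩
  have e : b * m ^ 2 + 2 * a * m * (p * Y - r * X + t * m) + c * (p * Y - r * X + t * m) ^ 2 =
      X ^ 2 - 2 * Y ^ 2 := by
    have e1 : b * m ^ 2 + 2 * a * m * (p * Y - r * X + t * m) + c * (p * Y - r * X + t * m) ^ 2 =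
        b' * (2 ^ k * m) ^ 2 + 2 * a' * (2 ^ k * m) * (p * Y - r * X) + c * (p * Y - r * X) ^ 2 := by
      linear_combination m ^ 2 * hb' + 2 * m * (p * Y - r * X) * ha'
    rw [e1, ← hm, h1, h2, h3]
    linear_combination (X ^ 2 - 2 * Y ^ 2) * h4
  rw [e, hXY]

/-- A primitive form with `a ^ 2 - b * c = 2 ^ (2 * k + 1)` represents `1` or `-1`. -/
theorem exists_form_sq_eq_one (k : ℕ) (a b c : ℤ) (h : a ^ 2 - 2 ^ (2 * k + 1) = b * c)
    (hgcd : Int.gcd (Int.gcd a b) c = 1) :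
    ∃ x y : ℤ, (b * x ^ 2 + 2 * a * x * y + c * y ^ 2) ^ 2 = 1 := by
  rcases Int.even_or_odd c with hc | hc
  · have hb : Odd b := by
      by_contra hb
      rw [Int.not_odd_iff_even] at hb
      have ha : Even a := by
        have : Even (a ^ 2) := by
          have e : a ^ 2 = b * c + 2 * 2 ^ (2 * k) := by linear_combination h
          rw [e]
          exact (hc.mul_left b).add (even_two_mul _)
        exact (Int.even_pow.1 this).1
      have := Int.dvd_coe_gcd (Int.dvd_coe_gcd ha.two_dvd hb.two_dvd) hc.two_dvd
      rw [hgcd] at this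
      omega
    obtain ⟨x, y, hxy⟩ := exists_form_sq_eq_one_of_odd k a c b (by rw [h, mul_comm]) hb
    exact ⟨y, x, by rw [← hxy]; ring⟩
  · exact exists_form_sq_eq_one_of_odd k a b c h hc

/-! ### Orbits -/

namespace IrrationalReal

theorem exists_smul_eq_of_form_eq {n : ℕ} {z : IrrationalReal} {a b c e r t : ℤ} (hc : c ≠ 0)
    (hz : (z : ℝ) = ((a : ℝ) + √(n : ℝ)) / (c : ℝ)) (hbc : a ^ 2 - (n : ℤ) = b * c)
    (hform : b * r ^ 2 + 2 * a * r * t + c * t ^ 2 = e) (he : e ^ 2 = 1) :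
    ∃ g : SL(2, ℤ), ((g • z : IrrationalReal) : ℝ) = e * √(n : ℝ) := by
  have hdet : (!![e * (r * a + t * c), -e * (r * b + t * a); r, t] : Matrix _ _ ℤ).det = 1 := by
    rw [Matrix.det_fin_two_of]
    linear_combination e * hform + he
  obtain ⟨g, h00, h01, h10, h11⟩ : ∃ g : SL(2, ℤ), g 0 0 = e * (r * a + t * c) ∧
      g 0 1 = -e * (r * b + t * a) ∧ g 1 0 = r ∧ g 1 1 = t := ⟨⟨_, hdet⟩, rfl, rfl, rfl, rfl⟩
  refine ⟨g, ?_⟩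
  rw [coe_smul, div_eq_iff (denom_ne_zero _ z)]
  have hcR : (c : ℝ) ≠ 0 := by exact_mod_cast hc
  have hs : √(n : ℝ) ^ 2 = n := Real.sq_sqrt (Nat.cast_nonneg n)
  have hbcR : (a : ℝ) ^ 2 - n = b * c := by exact_mod_cast hbc
  rw [h00, h01, h10, h11, hz]
  push_cast
  field_simp
  linear_combination (e : ℝ) * r * hbcR - (e : ℝ) * r * hs

end IrrationalReal

/-- A matrix `(p, q; r, t)` taking `√n` to `-√n` would have `t = -p` and `q = -n * r`, hence
`p ^ 2 - n * r ^ 2 = -1`. -/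
theorem smul_ne_neg_sqrt {n : ℕ} (hn : 4 ∣ n) {z w : IrrationalReal} (hz : (z : ℝ) = √(n : ℝ))
    (hw : (w : ℝ) = -√(n : ℝ)) (g : PSL(2, ℤ)) : g • z ≠ w := by
  induction g using QuotientGroup.induction_on with
  | H g =>
    intro hg
    change g • z = w at hg
    have hg' := congrArg (Subtype.val) hg
    have hden := IrrationalReal.denom_ne_zero g z
    have hirr := z.2
    rw [IrrationalReal.coe_smul, div_eq_iff hden, hw, hz] at hg'
    rw [hz] at hirr
    have hs : √(n : ℝ) ^ 2 = n := Real.sq_sqrt (Nat.cast_nonneg n)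
    have hdet := Matrix.det_fin_two g.1
    rw [g.2] at hdet
    change 1 = g 0 0 * g 1 1 - g 0 1 * g 1 0 at hdet
    generalize g 0 0 = p at *
    generalize g 0 1 = q at *
    generalize g 1 0 = r at *
    generalize g 1 1 = t at *
    -- Compare the coefficients of `1` and `√n`.
    have hlin : ((p + t : ℤ) : ℝ) * √(n : ℝ) + ((q + n * r : ℤ) : ℝ) = 0 := by
      push_cast
      linear_combination hg' - (r : ℝ) * hs
    have hpt : p + t = 0 := by
      by_contra h0
      exact ((hirr.intCast_mul h0).add_intCast _).ne_zero hlin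
    have hqr : q + n * r = 0 := by
      rw [hpt, Int.cast_zero, zero_mul, zero_add] at hlin
      exact_mod_cast hlin
    obtain ⟨m, rfl⟩ := hn
    have hpell : p ^ 2 + 1 = 4 * (m * r ^ 2) := by
      push_cast at hqr
      linear_combination p * hpt + hdet - r * hqr
    obtain ⟨p', rfl | rfl⟩ := Int.even_or_odd' p
    · ring_nf at hpell; omega
    · ring_nf at hpell; omega

theorem theorem2p8 (h k : ℕ) (hk : h = 2 * k + 1) (hh : 3 ≤ h) :
    ∃ α β : Qstar (2 ^ h),
      ((α : IrrationalReal) : ℝ) = 2 ^ k * √2 ∧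
      ((β : IrrationalReal) : ℝ) = 2 ^ k * √2 / (-1) ∧
      MulAction.orbit PSL(2, ℤ) α ≠ MulAction.orbit PSL(2, ℤ) β ∧
      Set.range (fun γ : Qstar (2 ^ h) => MulAction.orbit PSL(2, ℤ) γ) =
        {MulAction.orbit PSL(2, ℤ) α, MulAction.orbit PSL(2, ℤ) β} := by
  have hsqrt : √((2 ^ h : ℕ) : ℝ) = 2 ^ k * √2 := by
    rw [hk, pow_succ, pow_mul']
    push_cast
    rw [Real.sqrt_mul (by positivity), Real.sqrt_sq (by positivity)]
  have hirr : Irrational (2 ^ k * √2) := by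
    have := irrational_sqrt_two.natCast_mul (m := 2 ^ k) (by positivity)
    simpa using this
  have hirr' : Irrational (2 ^ k * √2 / (-1)) := by simpa [div_neg] using hirr.neg
  obtain ⟨α, hα⟩ : ∃ α : Qstar (2 ^ h), ((α : IrrationalReal) : ℝ) = 2 ^ k * √2 := by
    refine ⟨⟨⟨_, hirr⟩, 0, -2 ^ h, 1, one_ne_zero, ?_, ?_, ?_⟩, rfl⟩
    · simp [← hsqrt]
    · simp
    · simp
  obtain ⟨β, hβ⟩ : ∃ β : Qstar (2 ^ h), ((β : IrrationalReal) : ℝ) = 2 ^ k * √2 / (-1) := by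
    refine ⟨⟨⟨_, hirr'⟩, 0, 2 ^ h, -1, by norm_num, ?_, ?_, ?_⟩, rfl⟩
    · simp [← hsqrt]
    · simp
    · simp
  refine ⟨α, β, hα, hβ, ?_, ?_⟩
  · intro heq
    have hmem : β ∈ MulAction.orbit PSL(2, ℤ) α := heq ▸ MulAction.mem_orbit_self β
    obtain ⟨g, hg⟩ := hmem
    have h4 : 4 ∣ 2 ^ h := pow_dvd_pow 2 (show 2 ≤ h by omega)
    exact smul_ne_neg_sqrt h4 (hα.trans hsqrt.symm) (by rw [hβ, hsqrt, div_neg, div_one]) g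
      (congrArg Subtype.val hg)
  · have key : ∀ γ : Qstar (2 ^ h), MulAction.orbit PSL(2, ℤ) γ = MulAction.orbit PSL(2, ℤ) α ∨
        MulAction.orbit PSL(2, ℤ) γ = MulAction.orbit PSL(2, ℤ) β := by
      intro γ
      obtain ⟨a, b, c, hc, hz, hbc, hgcd⟩ := γ.2
      obtain ⟨r, t, hrt⟩ := exists_form_sq_eq_one k a b c (by rw [← hbc, hk]; push_cast; rfl) hgcd
      obtain ⟨g, hg⟩ := IrrationalReal.exists_smul_eq_of_form_eq hc hz hbc rfl hrt
      rw [hsqrt] at hg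
      rcases eq_or_eq_neg_of_sq_eq_sq _ 1 (hrt.trans (one_pow 2).symm) with he | he
      · left
        rw [he] at hg
        refine (MulAction.orbit_eq_iff.2 ⟨(QuotientGroup.mk g : PSL(2, ℤ)), ?_⟩).symm
        refine Subtype.ext (Subtype.ext (Eq.trans hg ?_))
        rw [hα]
        simp
      · right
        rw [he] at hg
        refine (MulAction.orbit_eq_iff.2 ⟨(QuotientGroup.mk g : PSL(2, ℤ)), ?_⟩).symm
        refine Subtype.ext (Subtype.ext (Eq.trans hg ?_))
        rw [hβ]
        simp [div_neg]
    ext S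
    constructor
    · rintro ⟨γ, rfl⟩
      exact key γ
    · rintro (rfl | rfl)
      · exact ⟨α, rfl⟩
      · exact ⟨β, rfl⟩
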